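/- Let $k$ be a field, $m\ge 0$, $R=k[x_1,\ldots,x_m]$ and $\mathfrak m=(x_1,\ldots,x_m)$, and regard $k=R/\mathfrak m$ as an $R$-module. Let $I\subsetneq R$ be a proper monomial ideal, i.e. a proper ideal generated by a (possibly empty) set of monomials. Then $I$ is of small type: for every $s\ge 1$ and every $i\ge 0$, the map $$\operatorname{Tor}^R_i(k,I^s)\longrightarrow \operatorname{Tor}^R_i(k,I^{s-1})$$ induced by the inclusion $I^s\subseteq I^{s-1}$ (with $I^0=R$) is zero. -/

import Mathlib

open CategoryTheory

universe u

noncomputable section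

namespace SmallType

/-- The graded maximal ideal `(x₁, …, xₘ)` of `k[x₁, …, xₘ]`. -/
def gradedMaximalIdeal (k : Type u) [Field k] (m : ℕ) : Ideal (MvPolynomial (Fin m) k) :=
  Ideal.span (Set.range MvPolynomial.X)

/-- The residue field `k = R / (x₁, …, xₘ)` as a module over `R = k[x₁, …, xₘ]`. -/
abbrev residueModule (k : Type u) [Field k] (m : ℕ) : ModuleCat.{u} (MvPolynomial (Fin m) k) :=
  ModuleCat.of (MvPolynomial (Fin m) k) (MvPolynomial (Fin m) k ⧸ gradedMaximalIdeal k m)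

/-- A homomorphism `φ : M → P` of `k[x₁, …, xₘ]`-modules is Tor-vanishing if
`Tor_i(k, φ) : Tor_i(k, M) → Tor_i(k, P)` is zero for all `i ≥ 0`. -/
def IsTorVanishing {k : Type u} [Field k] {m : ℕ} {M P : Type u}
    [AddCommGroup M] [Module (MvPolynomial (Fin m) k) M]
    [AddCommGroup P] [Module (MvPolynomial (Fin m) k) P]
    (φ : M →ₗ[MvPolynomial (Fin m) k] P) : Prop :=
  ∀ i : ℕ, ((Tor (ModuleCat.{u} (MvPolynomial (Fin m) k)) i).obj (residueModule k m)).map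
    (ModuleCat.ofHom φ) = 0

/-- An ideal is of small type if the inclusion `I ^ s → I ^ (s - 1)` is Tor-vanishing for
all `s ≥ 1`. -/
def IsOfSmallType {k : Type u} [Field k] {m : ℕ} (I : Ideal (MvPolynomial (Fin m) k)) : Prop :=
  ∀ s : ℕ, 1 ≤ s →
    IsTorVanishing (Submodule.inclusion (Ideal.pow_le_pow_right (Nat.sub_le s 1) :
      I ^ s ≤ I ^ (s - 1)))

/-- A monomial ideal is an ideal generated by a set of monomials. -/
def IsMonomialIdeal {k : Type u} [Field k] {m : ℕ} (I : Ideal (MvPolynomial (Fin m) k)) : Prop :=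
  ∃ A : Set (Fin m →₀ ℕ), I = Ideal.span ((fun a => MvPolynomial.monomial a (1 : k)) '' A)

end SmallType

end

/-! Let `S` be the set of exponents of the monomials in a monomial ideal. The elements `x ^ a •
[c]`, with `c` a nonempty list of exponents in `S` all bounded by `a`, span a free complex. In
multidegree `a`, together with the empty list, it is the augmented ordered chain complex of the full
simplex on the exponents of `S` below `a`. Coning from any one of these shows that it resolves the
ideal (`exists_boundary_eq`), and Tor is the homology of its reduction modulo the variables.

The inclusion of `I ^ (s + 1)` in `I ^ s` becomes an inclusion of complexes. In multidegree `a ≠ 0`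
choose a variable `x_i` dividing `x ^ a` and send `e` to `e ⊓ (a - single i 1)`. This is `e` or `e -
single i 1`, so it is an exponent of `I ^ s`, because dividing a monomial of `I ^ (s + 1)` by a
variable costs at most one generator (`sub_single_mem_exponents_pow`). The image of a chain is then
a multiple of `x_i`, hence zero modulo the variables, while the prism operator joins it to the
original chain. So every cycle modulo the variables bounds in the larger complex
(`exists_sub_boundary_mem`), and `tor_map_eq_zero` translates this to Tor. -/

noncomputable section

namespace SmallType

/-! ### Chains on lists -/

section ListChains

variable (A : Type*) [CommRing A] {α : Type*}

/-- Prepending `v` to every list, on the free module on lists. -/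
def consMap (v : α) : (List α →₀ A) →ₗ[A] (List α →₀ A) :=
  Finsupp.lmapDomain A A (List.cons v)

@[simp] lemma consMap_single (v : α) (c : List α) (p : A) :
    consMap A v (Finsupp.single c p) = Finsupp.single (v :: c) p := by
  simp [consMap]

/-- The alternating sum of the faces of a list. -/
def faces : List α → (List α →₀ A)
  | [] => 0
  | v :: c => Finsupp.single c 1 - consMap A v (faces c)

/-- The (augmented) simplicial boundary on the free module on lists. -/
def boundary : (List α →₀ A) →ₗ[A] (List α →₀ A) :=
  Finsupp.linearCombination A (faces A)

@[simp] lemma boundary_single_nil (p : A) :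
    boundary A (Finsupp.single ([] : List α) p) = 0 := by
  simp [boundary, faces]

/-- The cone identity: prepending a fixed vertex is a contracting homotopy, the source of exactness
below. -/
lemma boundary_consMap (v : α) (z : List α →₀ A) :
    boundary A (consMap A v z) = z - consMap A v (boundary A z) := by
  have : boundary A ∘ₗ consMap A v = LinearMap.id - consMap A v ∘ₗ boundary A := by
    ext c : 2
    simp [boundary, faces]
  exact LinearMap.congr_fun this z

lemma boundary_single_cons (v : α) (c : List α) (p : A) :
    boundary A (Finsupp.single (v :: c) p) =
      Finsupp.single c p - consMap A v (boundary A (Finsupp.single c p)) := by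
  rw [← consMap_single, boundary_consMap]

lemma boundary_boundary (z : List α →₀ A) : boundary A (boundary A z) = 0 := by
  induction z using Finsupp.induction_linear with
  | zero => simp
  | add x y hx hy => simp [hx, hy]
  | single c p =>
    induction c with
    | nil => simp
    | cons v c ih => simp [boundary_single_cons, boundary_consMap, ih]

variable (f : α → α)

/-- The prism on a list over the map `f`, with vertices in the list and its image under `f`. -/
def prismFaces : List α → (List α →₀ A)
  | [] => 0
  | v :: c => Finsupp.single (f v :: v :: c) 1 - consMap A (f v) (prismFaces c)

/-- The prism operator: a homotopy between the identity and the map induced by `f`. -/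
def prism : (List α →₀ A) →ₗ[A] (List α →₀ A) :=
  Finsupp.linearCombination A (prismFaces A f)

@[simp] lemma prism_single_nil (p : A) :
    prism A f (Finsupp.single ([] : List α) p) = 0 := by
  simp [prism, prismFaces]

lemma prism_consMap (v : α) (z : List α →₀ A) :
    prism A f (consMap A v z) =
      consMap A (f v) (consMap A v z) - consMap A (f v) (prism A f z) := by
  have : prism A f ∘ₗ consMap A v =
      consMap A (f v) ∘ₗ consMap A v - consMap A (f v) ∘ₗ prism A f := by
    ext c : 2
    simp [prism, prismFaces]
  exact LinearMap.congr_fun this z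

lemma prism_single_cons (v : α) (c : List α) (p : A) :
    prism A f (Finsupp.single (v :: c) p) =
      Finsupp.single (f v :: v :: c) p - consMap A (f v) (prism A f (Finsupp.single c p)) := by
  rw [← consMap_single, prism_consMap, consMap_single, consMap_single]

/-- The map induced by `f` on the free module on lists. -/
def mapLists : (List α →₀ A) →ₗ[A] (List α →₀ A) :=
  Finsupp.lmapDomain A A (List.map f)

@[simp] lemma mapLists_single (c : List α) (p : A) :
    mapLists A f (Finsupp.single c p) = Finsupp.single (c.map f) p := by
  simp [mapLists]

lemma boundary_prism_add (z : List α →₀ A) :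
    boundary A (prism A f z) + prism A f (boundary A z) = z - mapLists A f z := by
  induction z using Finsupp.induction_linear with
  | zero => simp
  | add x y hx hy =>
    simp only [map_add]
    rw [add_add_add_comm, hx, hy]
    abel
  | single c p =>
    induction c with
    | nil => simp
    | cons v c ih =>
      have ih' := congrArg (consMap A (f v)) ih
      simp only [map_add, map_sub, mapLists_single, consMap_single] at ih'
      simp only [boundary_single_cons, prism_single_cons, map_sub, boundary_consMap,
        prism_consMap, mapLists_single, List.map_cons, consMap_single]
      rw [← sub_eq_zero] at ih' ⊢
      rw [← ih']
      abel

end ListChains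

/-! ### Multigraded pieces -/

section Pieces

open MvPolynomial

variable {σ : Type*} {k : Type*} [CommRing k]

/-- The free `k[σ]`-module on lists of exponents. -/
abbrev ExpChains (σ : Type*) (k : Type*) [CommRing k] : Type _ :=
  List (σ →₀ ℕ) →₀ MvPolynomial σ k

/-- The lists of length `n` with entries in `S` which are bounded by `b`. -/
def boundedLists (S : Set (σ →₀ ℕ)) (n : ℕ) (b : σ →₀ ℕ) : Set (List (σ →₀ ℕ)) :=
  {c | c.length = n ∧ ∀ e ∈ c, e ∈ S ∧ e ≤ b}

/-- The `k`-span of the elements `x ^ a • [c]` where `c` is a list of length `n` in `S`,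
bounded by `b`. -/
def piece (k : Type*) [CommRing k] (S : Set (σ →₀ ℕ)) (n : ℕ) (a b : σ →₀ ℕ) :
    Submodule k (ExpChains σ k) :=
  Submodule.span k ((fun c => Finsupp.single c (monomial a 1)) '' boundedLists S n b)

variable {S S' : Set (σ →₀ ℕ)} {n : ℕ} {a b b' : σ →₀ ℕ}

lemma single_mem_piece {c : List (σ →₀ ℕ)} (hc : c ∈ boundedLists S n b) (r : k) :
    Finsupp.single c (monomial a r) ∈ piece k S n a b := by
  have : Finsupp.single c (monomial a r) =
      r • (Finsupp.single c (monomial a (1 : k)) : ExpChains σ k) := by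
    simp [smul_monomial]
  rw [this]
  exact Submodule.smul_mem _ _ (Submodule.subset_span ⟨c, hc, rfl⟩)

/-- Linear maps respect pieces as soon as they do so on generators. -/
lemma map_mem_of_mem_piece {O : ExpChains σ k →ₗ[MvPolynomial σ k] ExpChains σ k}
    {N : Submodule k (ExpChains σ k)}
    (h : ∀ c ∈ boundedLists S n b, O (Finsupp.single c (monomial a 1)) ∈ N)
    {z : ExpChains σ k} (hz : z ∈ piece k S n a b) : O z ∈ N := by
  have : piece k S n a b ≤ N.comap (O.restrictScalars k) := by
    refine Submodule.span_le.2 ?_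
    rintro _ ⟨c, hc, rfl⟩
    exact h c hc
  exact this hz

lemma cons_mem_boundedLists {v : σ →₀ ℕ} {c : List (σ →₀ ℕ)} (hc : c ∈ boundedLists S n b)
    (hv : v ∈ S) (hvb : v ≤ b) : v :: c ∈ boundedLists S (n + 1) b :=
  ⟨by simp [hc.1], by simpa [hv, hvb] using hc.2⟩

lemma of_cons_mem_boundedLists {v : σ →₀ ℕ} {c : List (σ →₀ ℕ)}
    (h : v :: c ∈ boundedLists S (n + 1) b) : c ∈ boundedLists S n b ∧ v ∈ S ∧ v ≤ b :=
  ⟨⟨by simpa using h.1, fun e he => h.2 e (by simp [he])⟩, h.2 v (by simp)⟩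

lemma consMap_mem_piece {v : σ →₀ ℕ} (hv : v ∈ S) (hvb : v ≤ b) {z : ExpChains σ k}
    (hz : z ∈ piece k S n a b) : consMap _ v z ∈ piece k S (n + 1) a b := by
  refine map_mem_of_mem_piece (fun c hc => ?_) hz
  rw [consMap_single]
  exact single_mem_piece (cons_mem_boundedLists hc hv hvb) 1

lemma piece_mono (hS : S ⊆ S') (hb : b ≤ b') : piece k S n a b ≤ piece k S' n a b' := by
  refine Submodule.span_mono (Set.image_mono fun c hc => ⟨hc.1, fun e he => ?_⟩)
  exact ⟨hS (hc.2 e he).1, (hc.2 e he).2.trans hb⟩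

lemma boundary_mem_piece {z : ExpChains σ k} (hz : z ∈ piece k S (n + 1) a b) :
    boundary _ z ∈ piece k S n a b := by
  refine map_mem_of_mem_piece (fun c hc => ?_) hz
  clear hz
  induction c generalizing n with
  | nil => simp
  | cons v c ih =>
    obtain ⟨hc', hv, hvb⟩ := of_cons_mem_boundedLists hc
    rw [boundary_single_cons]
    refine sub_mem (single_mem_piece hc' 1) ?_
    cases n with
    | zero =>
      obtain rfl : c = [] := by simpa using hc'.1
      simp
    | succ n => exact consMap_mem_piece hv hvb (ih hc')

lemma eq_nil_of_mem_boundedLists_zero {c : List (σ →₀ ℕ)} (hc : c ∈ boundedLists S 0 b) :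
    c = [] := by
  simpa using hc.1

/-- Since `f` only lowers exponents, the bound `b` survives even when it is smaller than the degree
`a` of the coefficient. This is what lets the prism preserve divisibility by a variable. -/
lemma prism_mem_piece {f : (σ →₀ ℕ) → σ →₀ ℕ} (hS : S ⊆ S')
    (hfS : ∀ e ∈ S, e ≤ b → f e ∈ S') (hfle : ∀ e, f e ≤ e)
    {z : ExpChains σ k} (hz : z ∈ piece k S n a b) :
    prism _ f z ∈ piece k S' (n + 1) a b := by
  refine map_mem_of_mem_piece (fun c hc => ?_) hz
  clear hz
  induction c generalizing n with
  | nil => simp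
  | cons v c ih =>
    obtain _ | n := n
    · simp [boundedLists] at hc
    obtain ⟨hc', hv, hvb⟩ := of_cons_mem_boundedLists hc
    rw [prism_single_cons, ← consMap_single]
    rw [← map_sub]
    refine consMap_mem_piece (hfS v hv hvb) ((hfle v).trans hvb) (sub_mem ?_ (ih hc'))
    exact piece_mono hS le_rfl (single_mem_piece hc 1)

lemma mapLists_mem_piece {f : (σ →₀ ℕ) → σ →₀ ℕ}
    (hf : ∀ e ∈ S, e ≤ b → f e ∈ S' ∧ f e ≤ b')
    {z : ExpChains σ k} (hz : z ∈ piece k S n a b) :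
    mapLists _ f z ∈ piece k S' n a b' := by
  refine map_mem_of_mem_piece (fun c hc => ?_) hz
  rw [mapLists_single]
  refine single_mem_piece ⟨by simp [hc.1], ?_⟩ 1
  intro e he
  obtain ⟨e', he', rfl⟩ := List.mem_map.1 he
  exact hf e' (hc.2 e' he').1 (hc.2 e' he').2

/-- The `k`-linear operator acting on the multidegree `a` part of the chains by `O a`. -/
def glue (O : (σ →₀ ℕ) → ExpChains σ k →ₗ[MvPolynomial σ k] ExpChains σ k) :
    ExpChains σ k →ₗ[k] ExpChains σ k :=
  Finsupp.lsum k fun c => (basisMonomials σ k).constr k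
    fun a => O a (Finsupp.single c (monomial a 1))

/-- The cone vertex and the map `f` must be chosen separately in each multidegree, so the homotopies
are only `k`-linear; this identity computes them degree by degree. -/
lemma glue_apply_of_mem_piece
    (O : (σ →₀ ℕ) → ExpChains σ k →ₗ[MvPolynomial σ k] ExpChains σ k)
    {z : ExpChains σ k} (hz : z ∈ piece k S n a b) : glue O z = O a z := by
  have : piece k S n a b ≤ LinearMap.eqLocus (glue O) ((O a).restrictScalars k) := by
    refine Submodule.span_le.2 ?_
    rintro _ ⟨c, -, rfl⟩
    have h := (basisMonomials σ k).constr_basis k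
      (fun a => O a (Finsupp.single c (monomial a 1))) a
    rw [coe_basisMonomials] at h
    simpa [glue] using h
  exact this hz

end Pieces

/-! ### The complex of monomial chains -/

section MonomialChains

open MvPolynomial

variable {σ : Type*} {k : Type*} [CommRing k]

/-- The `k[σ]`-span of the elements `x ^ a • [c]` where `c` is a list of length `n` in `S`
all of whose entries divide `x ^ a`. -/
def monomialChains (k : Type*) [CommRing k] (S : Set (σ →₀ ℕ)) (n : ℕ) :
    Submodule (MvPolynomial σ k) (ExpChains σ k) :=
  Submodule.span _ {z | ∃ a, ∃ c ∈ boundedLists S n a, z = Finsupp.single c (monomial a 1)}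

variable {S S' : Set (σ →₀ ℕ)} {n : ℕ} {a : σ →₀ ℕ}

lemma piece_le_monomialChains :
    piece k S n a a ≤ (monomialChains k S n).restrictScalars k := by
  refine Submodule.span_le.2 ?_
  rintro _ ⟨c, hc, rfl⟩
  exact Submodule.subset_span ⟨a, c, hc, rfl⟩

lemma monomialChains_induction {p : (z : ExpChains σ k) → z ∈ monomialChains k S n → Prop}
    (hp : ∀ a z (hz : z ∈ piece k S n a a), p z (piece_le_monomialChains hz))
    (hadd : ∀ x y hx hy, p x hx → p y hy → p (x + y) (add_mem hx hy))
    {z : ExpChains σ k} (hz : z ∈ monomialChains k S n) : p z hz := by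
  have h0 : p 0 (zero_mem _) := hp 0 0 (zero_mem _)
  -- Multiplying by a polynomial destroys homogeneity, so the induction carries all multiples of `z`
  -- and `q` is split into monomials.
  suffices h : ∀ q : MvPolynomial σ k, ∃ h, p (q • z) h by
    obtain ⟨h, hp⟩ := h 1
    simpa using hp
  induction hz using Submodule.span_induction with
  | mem z hz =>
    obtain ⟨a, c, hc, rfl⟩ := hz
    intro q
    induction q using MvPolynomial.induction_on' with
    | monomial b r =>
      refine ⟨_, hp (b + a) _ ?_⟩
      rw [Finsupp.smul_single, smul_eq_mul, monomial_mul, mul_one]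
      exact single_mem_piece ⟨hc.1, fun e he =>
        ⟨(hc.2 e he).1, (hc.2 e he).2.trans (by simp)⟩⟩ r
    | add q q' hq hq' =>
      rw [add_smul]
      exact ⟨_, hadd _ _ _ _ hq.2 hq'.2⟩
  | zero => intro q; simpa using h0
  | add x y _ _ hx hy =>
    intro q
    rw [smul_add]
    exact ⟨_, hadd _ _ _ _ (hx q).2 (hy q).2⟩
  | smul r x _ hx =>
    intro q
    rw [smul_smul]
    exact hx _

/-- The ideal generated by the variables. -/
local notation "𝔪" => Ideal.span (Set.range (X : σ → MvPolynomial σ k))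

/-- A slack of one variable between the coefficient and the bound on the entries is exactly a factor
`X i`. -/
lemma piece_le_smul_monomialChains (i : σ) :
    piece k S n (a + Finsupp.single i 1) a ≤ (𝔪 • monomialChains k S n).restrictScalars k := by
  refine Submodule.span_le.2 ?_
  rintro _ ⟨c, hc, rfl⟩
  have : (Finsupp.single c (monomial (a + Finsupp.single i 1) (1 : k)) : ExpChains σ k) =
      (X i : MvPolynomial σ k) • Finsupp.single c (monomial a 1) := by
    rw [Finsupp.smul_single, smul_eq_mul, X, monomial_mul, add_comm, mul_one]
  change Finsupp.single c (monomial (a + Finsupp.single i 1) (1 : k)) ∈ 𝔪 • monomialChains k S n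
  rw [this]
  exact Submodule.smul_mem_smul (Ideal.subset_span ⟨i, rfl⟩)
    (Submodule.subset_span ⟨a, c, hc, rfl⟩)

lemma smul_monomialChains_induction
    {p : (z : ExpChains σ k) → z ∈ 𝔪 • monomialChains k S n → Prop} (h0 : p 0 (zero_mem _))
    (hp : ∀ a i z (hz : z ∈ piece k S n (a + Finsupp.single i 1) a),
      p z (piece_le_smul_monomialChains i hz))
    (hadd : ∀ x y hx hy, p x hx → p y hy → p (x + y) (add_mem hx hy))
    {z : ExpChains σ k} (hz : z ∈ 𝔪 • monomialChains k S n) : p z hz := by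
  suffices h : ∃ h, p z h from h.2
  induction hz using Submodule.smul_induction_on' with
  | add x _ y _ hx hy => exact ⟨_, hadd _ _ _ _ hx.2 hy.2⟩
  | smul r hr z hz =>
    induction hr using Submodule.span_induction generalizing z with
    | zero => simpa using h0
    | add q q' _ _ hq hq' =>
      rw [add_smul]
      exact ⟨_, hadd _ _ _ _ (hq z hz).2 (hq' z hz).2⟩
    | smul q q' _ hq' =>
      rw [smul_eq_mul, mul_comm, mul_smul]
      exact hq' _ (Submodule.smul_mem _ _ hz)
    | mem q hq =>
      obtain ⟨i, rfl⟩ := hq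
      induction hz using monomialChains_induction with
      | hadd x y _ _ hx hy =>
        rw [smul_add]
        exact ⟨_, hadd _ _ _ _ hx.2 hy.2⟩
      | hp a z hz =>
        refine ⟨_, hp a i _ (map_mem_of_mem_piece (O := LinearMap.lsmul _ _ (X i))
          (fun c hc => ?_) hz)⟩
        rw [LinearMap.lsmul_apply, Finsupp.smul_single, smul_eq_mul, X, monomial_mul, add_comm,
          mul_one]
        exact single_mem_piece hc 1

lemma monomialChains_mono (hS : S ⊆ S') : monomialChains k S n ≤ monomialChains k S' n := by
  intro z hz
  induction hz using monomialChains_induction with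
  | hp a z hz => exact piece_le_monomialChains (piece_mono hS le_rfl hz)
  | hadd x y _ _ hx hy => exact add_mem hx hy

lemma boundary_mem_monomialChains {z : ExpChains σ k} (hz : z ∈ monomialChains k S (n + 1)) :
    boundary _ z ∈ monomialChains k S n := by
  induction hz using monomialChains_induction with
  | hp a z hz => exact piece_le_monomialChains (boundary_mem_piece hz)
  | hadd x y _ _ hx hy => rw [map_add]; exact add_mem hx hy

/-- A list divides `x ^ a` entrywise iff its lcm does, so the elements `x ^ lcm c • [c]` form a
basis. -/
lemma monomialChains_free [IsDomain k] : Module.Free (MvPolynomial σ k) (monomialChains k S n) := by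
  classical
  let lcm (c : List (σ →₀ ℕ)) : σ →₀ ℕ := c.foldr (· ⊔ ·) 0
  have hlcm (c : List (σ →₀ ℕ)) (b : σ →₀ ℕ) : lcm c ≤ b ↔ ∀ e ∈ c, e ≤ b := by
    induction c with
    | nil => simp [lcm]
    | cons v c ih =>
      have : lcm (v :: c) = v ⊔ lcm c := rfl
      simp [this, ih]
  let good : Set (List (σ →₀ ℕ)) := {c | c.length = n ∧ ∀ e ∈ c, e ∈ S}
  let B (c : good) : ExpChains σ k := Finsupp.single c.1 (monomial (lcm c.1) 1)
  have hB : LinearIndependent (MvPolynomial σ k) B := by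
    have := Finsupp.linearIndependent_single (R := MvPolynomial σ k) (φ := fun _ => Unit)
      (fun (c : List (σ →₀ ℕ)) (_ : Unit) => (monomial (lcm c) 1 : MvPolynomial σ k))
      (fun c => LinearIndependent.of_subsingleton () (by simp))
    exact this.comp (fun c : good => (⟨c.1, ()⟩ : Σ _ : List (σ →₀ ℕ), Unit))
      (fun c c' h => Subtype.ext (congrArg Sigma.fst h))
  have hspan : Submodule.span (MvPolynomial σ k) (Set.range B) = monomialChains k S n := by
    apply le_antisymm
    · refine Submodule.span_le.2 ?_
      rintro _ ⟨c, rfl⟩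
      exact Submodule.subset_span ⟨lcm c.1, c.1, ⟨c.2.1, fun e he =>
        ⟨c.2.2 e he, (hlcm _ _).1 le_rfl e he⟩⟩, rfl⟩
    · refine Submodule.span_le.2 ?_
      rintro _ ⟨a, c, hc, rfl⟩
      have hle : lcm c ≤ a := (hlcm c a).2 fun e he => (hc.2 e he).2
      have : (Finsupp.single c (monomial a (1 : k)) : ExpChains σ k) =
          (monomial (a - lcm c) (1 : k)) • B ⟨c, hc.1, fun e he => (hc.2 e he).1⟩ := by
        simp only [B]
        rw [Finsupp.smul_single, smul_eq_mul, monomial_mul, tsub_add_cancel_of_le hle, mul_one]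
      rw [this]
      exact Submodule.smul_mem _ _ (Submodule.subset_span ⟨_, rfl⟩)
  rw [← hspan]
  exact Module.Free.of_basis (Module.Basis.span hB)

/-- Cycles of monomial chains are boundaries. -/
lemma exists_boundary_eq {z : ExpChains σ k} (hz : z ∈ monomialChains k S (n + 1))
    (hdz : boundary _ z = 0) : ∃ w ∈ monomialChains k S (n + 2), boundary _ w = z := by
  classical
  -- The cone vertex in multidegree `a`. The lists have positive length, so their head shows that a
  -- vertex exists; for them the value `0` is never reached.
  let v (a : σ →₀ ℕ) : σ →₀ ℕ := if h : ∃ e ∈ S, e ≤ a then h.choose else 0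
  have hv {a : σ →₀ ℕ} (h : ∃ e ∈ S, e ≤ a) : v a ∈ S ∧ v a ≤ a := by
    simp only [v, dif_pos h]
    exact h.choose_spec
  let O (a : σ →₀ ℕ) : ExpChains σ k →ₗ[MvPolynomial σ k] ExpChains σ k := consMap _ (v a)
  have hmem : glue O z ∈ monomialChains k S (n + 2) := by
    clear hdz
    induction hz using monomialChains_induction with
    | hadd x y _ _ hx hy => rw [map_add]; exact add_mem hx hy
    | hp a z hz =>
      rw [glue_apply_of_mem_piece O hz]
      refine piece_le_monomialChains (a := a) (map_mem_of_mem_piece (fun c hc => ?_) hz)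
      obtain _ | ⟨e, c⟩ := c
      · simp [boundedLists] at hc
      have hva := hv ⟨e, hc.2 e (by simp)⟩
      rw [consMap_single]
      exact single_mem_piece (cons_mem_boundedLists hc hva.1 hva.2) 1
  have hhom : boundary _ (glue O z) + glue O (boundary _ z) = z := by
    clear hdz hmem
    induction hz using monomialChains_induction with
    | hadd x y _ _ hx hy =>
      simp only [map_add]
      rw [add_add_add_comm, hx, hy]
    | hp a z hz =>
      rw [glue_apply_of_mem_piece O hz, glue_apply_of_mem_piece O (boundary_mem_piece hz),
        boundary_consMap, sub_add_cancel]
  refine ⟨_, hmem, ?_⟩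
  rwa [hdz, map_zero, add_zero] at hhom

/-- Removing a variable from elements of `S` lands in `S'`: then cycles modulo the variables
of chains in `S` are boundaries modulo the variables of chains in `S'`. -/
lemma exists_sub_boundary_mem (hS : S ⊆ S')
    (hdiv : ∀ e ∈ S, ∀ i, e i ≠ 0 → e - Finsupp.single i 1 ∈ S') (h0 : (0 : σ →₀ ℕ) ∉ S)
    {z : ExpChains σ k} (hz : z ∈ monomialChains k S (n + 1))
    (hdz : n = 0 ∨ boundary _ z ∈ 𝔪 • monomialChains k S n) :
    ∃ w ∈ monomialChains k S' (n + 2), z - boundary _ w ∈ 𝔪 • monomialChains k S' (n + 1) := by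
  classical
  let f (a e : σ →₀ ℕ) : σ →₀ ℕ :=
    if h : ∃ i, a i ≠ 0 then e ⊓ (a - Finsupp.single h.choose 1) else e
  have hfle (a e : σ →₀ ℕ) : f a e ≤ e := by
    simp only [f]
    split_ifs
    · exact inf_le_left
    · exact le_rfl
  have hfS (a e : σ →₀ ℕ) (he : e ∈ S) (hea : e ≤ a) : f a e ∈ S' := by
    simp only [f]
    split_ifs with h
    -- Either `e` already lies below `a - single i 1` and is fixed, or its `i`-th entry equals that
    -- of `a` and exactly one factor `x_i` is removed.
    · by_cases hlt : e h.choose < a h.choose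
      · convert hS he using 1
        refine inf_eq_left.2 fun i => ?_
        by_cases hi : h.choose = i
        · subst hi
          simp only [Finsupp.tsub_apply, Finsupp.single_eq_same]
          omega
        · simpa [Finsupp.single_apply, hi] using hea i
      · have heq : e h.choose = a h.choose := le_antisymm (hea _) (not_lt.1 hlt)
        convert hdiv e he h.choose (heq ▸ h.choose_spec) using 1
        ext i
        have := hea i
        by_cases hi : h.choose = i
        · rw [hi] at heq ⊢
          simp [heq]
        · simpa [Finsupp.single_apply, hi] using this
    · exact hS he
  let O (a : σ →₀ ℕ) : ExpChains σ k →ₗ[MvPolynomial σ k] ExpChains σ k := prism _ (f a)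
  have hmem : glue O z ∈ monomialChains k S' (n + 2) := by
    clear hdz
    induction hz using monomialChains_induction with
    | hadd x y _ _ hx hy => rw [map_add]; exact add_mem hx hy
    | hp a z hz =>
      rw [glue_apply_of_mem_piece O hz]
      exact piece_le_monomialChains (prism_mem_piece hS (hfS a) (hfle a) hz)
  have hhom : z - boundary _ (glue O z) - glue O (boundary _ z) ∈
      𝔪 • monomialChains k S' (n + 1) := by
    clear hdz hmem
    induction hz using monomialChains_induction with
    | hadd x y _ _ hx hy =>
      convert add_mem hx hy using 1
      simp only [map_add]
      abel
    | hp a z hz =>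
      rw [glue_apply_of_mem_piece O hz, glue_apply_of_mem_piece O (boundary_mem_piece hz),
        sub_sub, boundary_prism_add, sub_sub_cancel]
      refine map_mem_of_mem_piece (N := (𝔪 • monomialChains k S' (n + 1)).restrictScalars k)
        (fun c hc => ?_) hz
      obtain _ | ⟨e, c⟩ := c
      · simp [boundedLists] at hc
      obtain ⟨heS, hea⟩ := hc.2 e (by simp)
      -- In multidegree `0` the only possible entry would be `0`, which `h0` excludes; so a variable
      -- to remove exists.
      have ha : ∃ i, a i ≠ 0 := by
        by_contra! h
        have : e = 0 := Finsupp.ext fun i => by simpa [h i] using hea i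
        exact h0 (this ▸ heS)
      have hai : a = (a - Finsupp.single ha.choose 1) + Finsupp.single ha.choose 1 := by
        refine (tsub_add_cancel_of_le ?_).symm
        rw [Finsupp.single_le_iff]
        exact Nat.one_le_iff_ne_zero.2 ha.choose_spec
      have := mapLists_mem_piece (f := f a) (S' := S') (b' := a - Finsupp.single ha.choose 1)
        (fun e he hea => ⟨hfS a e he hea, by simp only [f, dif_pos ha]; exact inf_le_right⟩)
        (single_mem_piece (a := a) hc (1 : k))
      generalize a - Finsupp.single ha.choose 1 = a' at hai this
      rw [hai] at this
      have := piece_le_smul_monomialChains _ this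
      rwa [← hai] at this
  -- For `n = 0` the boundary sits on the empty list, which the prism kills. Otherwise it lies in `𝔪
  -- • monomialChains k S n`, and the prism keeps the slack of one variable.
  have hglue : glue O (boundary _ z) ∈ 𝔪 • monomialChains k S' (n + 1) := by
    rcases hdz with rfl | hdz
    · clear hmem hhom
      induction hz using monomialChains_induction with
      | hadd x y _ _ hx hy => simp only [map_add]; exact add_mem hx hy
      | hp a z hz =>
        have hz' := boundary_mem_piece hz
        rw [glue_apply_of_mem_piece O hz']
        refine map_mem_of_mem_piece (N := (𝔪 • monomialChains k S' 1).restrictScalars k)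
          (fun c hc => ?_) hz'
        simp [O, eq_nil_of_mem_boundedLists_zero hc]
    · generalize boundary (MvPolynomial σ k) z = y at hdz
      clear hhom
      induction hdz using smul_monomialChains_induction with
      | h0 => simp
      | hadd x y _ _ hx hy => rw [map_add]; exact add_mem hx hy
      | hp a i z hz =>
        rw [glue_apply_of_mem_piece O hz]
        exact piece_le_smul_monomialChains i (prism_mem_piece hS
          (fun e he hea => hfS _ e he (hea.trans (by simp))) (hfle _) hz)
  refine ⟨_, hmem, ?_⟩
  simpa using add_mem hhom hglue

end MonomialChains

/-! ### Powers of monomial ideals -/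

section MonomialIdeals

open MvPolynomial

variable {σ : Type*} {k : Type*} [CommRing k]

/-- The exponents of the monomials in an ideal. -/
def exponents (I : Ideal (MvPolynomial σ k)) : Set (σ →₀ ℕ) :=
  {e | monomial e 1 ∈ I}

lemma monomial_mem_of_mem_exponents {I : Ideal (MvPolynomial σ k)} {e a : σ →₀ ℕ}
    (he : e ∈ exponents I) (hea : e ≤ a) (r : k) : monomial a r ∈ I := by
  have : monomial a r = monomial (a - e) r * monomial e 1 := by
    rw [monomial_mul, tsub_add_cancel_of_le hea, mul_one]
  rw [this]
  exact I.mul_mem_left _ he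

lemma mem_exponents_of_le {I : Ideal (MvPolynomial σ k)} {e a : σ →₀ ℕ}
    (he : e ∈ exponents I) (hea : e ≤ a) : a ∈ exponents I :=
  monomial_mem_of_mem_exponents he hea 1

/-- The sums of `s` elements of `A`. -/
def sums (A : Set (σ →₀ ℕ)) : ℕ → Set (σ →₀ ℕ)
  | 0 => {0}
  | s + 1 => Set.image2 (· + ·) (sums A s) A

lemma span_monomial_pow (A : Set (σ →₀ ℕ)) (s : ℕ) :
    Ideal.span ((fun a => monomial a (1 : k)) '' A) ^ s =
      Ideal.span ((fun a => monomial a (1 : k)) '' sums A s) := by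
  induction s with
  | zero => simp [sums]
  | succ s ih =>
    rw [pow_succ, ih, Ideal.span_mul_span', sums, Set.image_image2]
    congr 1
    ext p
    simp [Set.mem_mul, monomial_mul]

lemma mem_support_mem_exponents_pow (A : Set (σ →₀ ℕ)) (s : ℕ) {p : MvPolynomial σ k}
    (hp : p ∈ Ideal.span ((fun a => monomial a (1 : k)) '' A) ^ s) {a : σ →₀ ℕ}
    (ha : a ∈ p.support) :
    a ∈ exponents (Ideal.span ((fun a => monomial a (1 : k)) '' A) ^ s) := by
  rw [span_monomial_pow] at hp ⊢
  obtain ⟨e, he, hea⟩ := mem_ideal_span_monomial_image.1 hp a ha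
  exact mem_exponents_of_le (Ideal.subset_span ⟨e, he, rfl⟩) hea

lemma sub_single_mem_exponents_pow [Nontrivial k] (A : Set (σ →₀ ℕ)) (s : ℕ) {e : σ →₀ ℕ}
    (he : e ∈ exponents (Ideal.span ((fun a => monomial a (1 : k)) '' A) ^ (s + 1))) (i : σ)
    (hei : e i ≠ 0) :
    e - Finsupp.single i 1 ∈ exponents (Ideal.span ((fun a => monomial a (1 : k)) '' A) ^ s) := by
  classical
  induction s generalizing e with
  | zero => simp [exponents]
  | succ s ih =>
    have hgen {s : ℕ} {g : σ →₀ ℕ} (hg : g ∈ sums A s) :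
        g ∈ exponents (Ideal.span ((fun a => monomial a (1 : k)) '' A) ^ s) := by
      rw [span_monomial_pow]
      exact Ideal.subset_span ⟨g, hg, rfl⟩
    have he' := he
    rw [span_monomial_pow] at he'
    obtain ⟨_, ⟨g, hg, g', hg', rfl⟩, hle⟩ := mem_ideal_span_monomial_image.1 he' e (by simp)
    -- If `g` does not use up the whole power of `x_i` in `e`, it still divides after the removal,
    -- and only `g'` is given up. Otherwise `g i = e i`, so the factor is removed from `g` by
    -- induction and `g'` is kept.
    by_cases hi : g i < e i
    · refine mem_exponents_of_le (hgen hg) fun j => ?_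
      have := hle j
      simp only [Finsupp.add_apply] at this
      by_cases hj : i = j
      · subst hj
        simp only [Finsupp.tsub_apply, Finsupp.single_eq_same]
        omega
      · simp only [Finsupp.tsub_apply, Finsupp.single_apply, hj, if_false]
        omega
    · have h1 := ih (hgen hg) (by omega)
      have h2 : (g - Finsupp.single i 1) + g' ∈
          exponents (Ideal.span ((fun a => monomial a (1 : k)) '' A) ^ (s + 1)) := by
        have : monomial (g - Finsupp.single i 1 + g') (1 : k) =
            monomial (g - Finsupp.single i 1) 1 * monomial g' 1 := by simp [monomial_mul]
        rw [exponents, Set.mem_ofPred, this, pow_succ]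
        exact Ideal.mul_mem_mul h1 (Ideal.subset_span ⟨g', hg', rfl⟩)
      refine mem_exponents_of_le h2 fun j => ?_
      have := hle j
      simp only [Finsupp.add_apply] at this
      by_cases hj : i = j
      · subst hj
        simp only [Finsupp.add_apply, Finsupp.tsub_apply, Finsupp.single_eq_same]
        omega
      · simp only [Finsupp.add_apply, Finsupp.tsub_apply, Finsupp.single_apply, hj, if_false]
        omega

end MonomialIdeals

/-! ### Complexes of submodules -/

section Homological

open Limits HomologicalComplex TensorProduct MonoidalCategory

variable {R : Type u} [CommRing R]

/-- A chain map sending every cycle to a boundary vanishes in homology. -/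
lemma homologyMap_eq_zero {C D : ChainComplex (ModuleCat.{u} R) ℕ} (g : C ⟶ D) (n : ℕ)
    (h : ∀ x : C.X n, (∀ j, C.d n j x = 0) → ∃ y : D.X (n + 1), D.d (n + 1) n y = g.f n x) :
    homologyMap g n = 0 := by
  rw [← cancel_epi (C.homologyπ n), homologyπ_naturality, comp_zero]
  ext x
  obtain ⟨y, hy⟩ := h (C.iCycles n x) (fun j => by
    exact ConcreteCategory.congr_hom (C.iCycles_d n j) x)
  have : cyclesMap g n x = D.toCycles (n + 1) n y := by
    have hinj : Function.Injective (D.iCycles n) := (ModuleCat.mono_iff_injective _).1 inferInstance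
    apply hinj
    have h1 := ConcreteCategory.congr_hom (cyclesMap_i g n) x
    have h2 := ConcreteCategory.congr_hom (D.toCycles_i (n + 1) n) y
    simp only [ConcreteCategory.comp_apply] at h1 h2
    rw [h1, h2, hy]
  have h3 := ConcreteCategory.congr_hom (D.toCycles_comp_homologyπ (n + 1) n) y
  simp only [ConcreteCategory.comp_apply] at h3 ⊢
  rw [this, h3]
  rfl

variable {T : Type u} [AddCommGroup T] [Module R T]

/-- The complex formed by submodules of a module with a differential. -/
def subcomplex (δ : T →ₗ[R] T) (hδ : ∀ z, δ (δ z) = 0) (F : ℕ → Submodule R T)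
    (hF : ∀ n, ∀ z ∈ F (n + 1), δ z ∈ F n) : ChainComplex (ModuleCat.{u} R) ℕ :=
  ChainComplex.of (fun n => ModuleCat.of R (F n)) (fun n => ModuleCat.ofHom (δ.restrict (hF n)))
    (fun n => by
      ext z
      exact hδ _)

variable (δ : T →ₗ[R] T) (hδ : ∀ z, δ (δ z) = 0) (F : ℕ → Submodule R T)
    (hF : ∀ n, ∀ z ∈ F (n + 1), δ z ∈ F n)

lemma subcomplex_d (n : ℕ) :
    (subcomplex δ hδ F hF).d (n + 1) n = ModuleCat.ofHom (δ.restrict (hF n)) :=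
by
  simp only [subcomplex, ChainComplex.of_d]

lemma exact_subcomplex_succ (hex : ∀ n, ∀ z ∈ F (n + 1), δ z = 0 → ∃ w ∈ F (n + 2), δ w = z)
    (n : ℕ) : (subcomplex δ hδ F hF).ExactAt (n + 1) := by
  rw [exactAt_iff' _ (n + 2) (n + 1) n (by simp) (by simp), ShortComplex.moduleCat_exact_iff]
  intro z hz
  change (subcomplex δ hδ F hF).d (n + 1) n z = 0 at hz
  change ∃ w, (subcomplex δ hδ F hF).d (n + 2) (n + 1) w = z
  rw [subcomplex_d] at hz ⊢
  obtain ⟨w, hw, hwz⟩ := hex n z.1 z.2 (congrArg Subtype.val hz)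
  exact ⟨⟨w, hw⟩, Subtype.ext hwz⟩

variable {F} {M : Type u} [AddCommGroup M] [Module R M] (ε : F 0 →ₗ[R] M)

lemma subcomplex_d_comp_augmentation (hδε : ∀ z : F 0, ε z = 0 ↔ ∃ w : F 1, δ w = z) :
    (subcomplex δ hδ F hF).d 1 0 ≫ ModuleCat.ofHom ε = 0 := by
  rw [subcomplex_d]
  ext z
  exact (hδε _).2 ⟨z, rfl⟩

/-- A complex of projective submodules, exact in positive degrees, resolves the
cokernel of its last differential. -/
def subcomplexResolution [∀ n, Module.Projective R (F n)] (hε : Function.Surjective ε)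
    (hδε : ∀ z : F 0, ε z = 0 ↔ ∃ w : F 1, δ w = z)
    (hex : ∀ n, ∀ z ∈ F (n + 1), δ z = 0 → ∃ w ∈ F (n + 2), δ w = z) :
    ProjectiveResolution (ModuleCat.of R M) where
  complex := subcomplex δ hδ F hF
  projective n := inferInstanceAs (Projective (ModuleCat.of R (F n)))
  π := (ChainComplex.toSingle₀Equiv _ _).symm
    ⟨ModuleCat.ofHom ε, subcomplex_d_comp_augmentation δ hδ hF ε hδε⟩
  quasiIso := ⟨fun n => by
    cases n with
    | zero =>
      rw [ChainComplex.quasiIsoAt₀_iff, ShortComplex.quasiIso_iff_of_zeros' _ rfl rfl rfl]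
      refine (ShortComplex.exact_and_epi_g_iff_of_iso
        (S₂ := ShortComplex.mk _ _ (subcomplex_d_comp_augmentation δ hδ hF ε hδε))
        (ShortComplex.isoMk (Iso.refl _) (Iso.refl _) (Iso.refl _) ?_ ?_)).2 ⟨?_, ?_⟩
      · exact (Category.id_comp _).trans (Category.comp_id _).symm
      · refine (Category.id_comp _).trans (Eq.trans ?_ (Category.comp_id _).symm)
        exact (ChainComplex.toSingle₀Equiv_symm_apply_f_zero (C := subcomplex δ hδ F hF)
          (ModuleCat.ofHom ε) (subcomplex_d_comp_augmentation δ hδ hF ε hδε)).symm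
      · rw [ShortComplex.moduleCat_exact_iff]
        intro z hz
        obtain ⟨w, hw⟩ := (hδε z).1 hz
        refine ⟨w, ?_⟩
        change (subcomplex δ hδ F hF).d 1 0 w = z
        rw [subcomplex_d]
        exact Subtype.ext hw
      · rw [ModuleCat.epi_iff_surjective]
        exact hε
    | succ n =>
      rw [quasiIsoAt_iff_exactAt' (hL := ChainComplex.exactAt_succ_single_obj ..)]
      exact exact_subcomplex_succ δ hδ F hF hex n⟩

variable {G : ℕ → Submodule R T} (hG : ∀ n, ∀ z ∈ G (n + 1), δ z ∈ G n)

/-- The chain map given by an inclusion of families of submodules. -/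
def subcomplexInclusion (hFG : ∀ n, F n ≤ G n) :
    subcomplex δ hδ F hF ⟶ subcomplex δ hδ G hG where
  f n := ModuleCat.ofHom (Submodule.inclusion (hFG n))
  comm' i j hij := by
    obtain rfl : j + 1 = i := hij
    rw [subcomplex_d, subcomplex_d]
    rfl

lemma exists_one_tmul (J : Ideal R) {N : Type*} [AddCommGroup N] [Module R N]
    (x : TensorProduct R (R ⧸ J) N) : ∃ z : N, x = (1 : R ⧸ J) ⊗ₜ[R] z := by
  obtain ⟨z, hz⟩ := Submodule.Quotient.mk_surjective _ (TensorProduct.quotTensorEquivQuotSMul N J x)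
  refine ⟨z, ?_⟩
  rw [← TensorProduct.quotTensorEquivQuotSMul_symm_mk, hz, LinearEquiv.symm_apply_apply]

lemma one_tmul_eq_zero_iff (J : Ideal R) (N : Submodule R T) (z : N) :
    (1 : R ⧸ J) ⊗ₜ[R] z = 0 ↔ (z : T) ∈ J • N := by
  rw [← (TensorProduct.quotTensorEquivQuotSMul N J).map_eq_zero_iff,
    TensorProduct.quotTensorEquivQuotSMul_mk_one_tmul, Submodule.Quotient.mk_eq_zero]
  have : J • N = (J • (⊤ : Submodule R N)).map N.subtype := by
    rw [Submodule.map_smul'', Submodule.map_top, Submodule.range_subtype]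
  rw [this]
  exact (N.injective_subtype.mem_set_image (s := ↑(J • (⊤ : Submodule R N)))).symm

/-- If cycles modulo `J` of the complex `F` are boundaries modulo `J` in the complex `G`, then the
map induced on `Tor (R ⧸ J)` vanishes. -/
theorem tor_map_eq_zero (hδ : ∀ z, δ (δ z) = 0) (hF : ∀ n, ∀ z ∈ F (n + 1), δ z ∈ F n)
    (hG : ∀ n, ∀ z ∈ G (n + 1), δ z ∈ G n) (J : Ideal R) [∀ n, Module.Projective R (F n)]
    [∀ n, Module.Projective R (G n)] {N : Type u} [AddCommGroup N] [Module R N]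
    (ε' : G 0 →ₗ[R] N) (hε : Function.Surjective ε) (hε' : Function.Surjective ε')
    (hδε : ∀ z : F 0, ε z = 0 ↔ ∃ w : F 1, δ w = z)
    (hδε' : ∀ z : G 0, ε' z = 0 ↔ ∃ w : G 1, δ w = z)
    (hex : ∀ n, ∀ z ∈ F (n + 1), δ z = 0 → ∃ w ∈ F (n + 2), δ w = z)
    (hex' : ∀ n, ∀ z ∈ G (n + 1), δ z = 0 → ∃ w ∈ G (n + 2), δ w = z)
    (hFG : ∀ n, F n ≤ G n) (φ : M →ₗ[R] N)
    (hφ : ∀ z : F 0, ε' (Submodule.inclusion (hFG 0) z) = φ (ε z))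
    (h0 : ∀ z ∈ F 0, ∃ w ∈ G 1, z - δ w ∈ J • G 0)
    (hs : ∀ n, ∀ z ∈ F (n + 1), δ z ∈ J • F n → ∃ w ∈ G (n + 2), z - δ w ∈ J • G (n + 1))
    (i : ℕ) :
    ((Tor (ModuleCat.{u} R) i).obj (ModuleCat.of R (R ⧸ J))).map (ModuleCat.ofHom φ) = 0 := by
  let P := subcomplexResolution δ hδ hF ε hε hδε hex
  let Q := subcomplexResolution δ hδ hG ε' hε' hδε' hex'
  let g : P.complex ⟶ Q.complex := subcomplexInclusion δ hδ hF hG hFG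
  have hg : g ≫ Q.π = P.π ≫ (ChainComplex.single₀ _).map (ModuleCat.ofHom φ) := by
    apply (ChainComplex.toSingle₀Equiv _ _).injective
    apply Subtype.ext
    change g.f 0 ≫ Q.π.f 0 = P.π.f 0 ≫ ((ChainComplex.single₀ _).map (ModuleCat.ofHom φ)).f 0
    rw [ChainComplex.single₀_map_f_zero]
    have hP : P.π.f 0 = ModuleCat.ofHom ε := ChainComplex.toSingle₀Equiv_symm_apply_f_zero
      (C := subcomplex δ hδ F hF) _ (subcomplex_d_comp_augmentation δ hδ hF ε hδε)
    have hQ : Q.π.f 0 = ModuleCat.ofHom ε' := ChainComplex.toSingle₀Equiv_symm_apply_f_zero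
      (C := subcomplex δ hδ G hG) _ (subcomplex_d_comp_augmentation δ hδ hG ε' hδε')
    rw [hP, hQ]
    ext z
    exact hφ z
  refine (Functor.leftDerived_map_eq _ i (ModuleCat.ofHom φ) g hg).trans ?_
  suffices h : homologyMap (((MonoidalCategory.tensoringLeft (ModuleCat.{u} R)).obj
      (ModuleCat.of R (R ⧸ J))).mapHomologicalComplex _ |>.map g) i = 0 by
    erw [Functor.comp_map, homologyFunctor_map, h, zero_comp, comp_zero]
    rfl
  refine homologyMap_eq_zero _ i fun x hx => ?_
  -- Working with representatives `1 ⊗ z` turns cycles and boundaries after tensoring into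
  -- congruences modulo `J`.
  obtain ⟨z, rfl⟩ := exists_one_tmul J (N := F i) x
  have hw : ∃ w ∈ G (i + 1), z.1 - δ w ∈ J • G i := by
    cases i with
    | zero => exact h0 z z.2
    | succ n =>
      refine hs n z z.2 ?_
      have := hx n
      change (ModuleCat.of R (R ⧸ J) ◁ (subcomplex δ hδ F hF).d (n + 1) n) _ = 0 at this
      rw [subcomplex_d] at this
      exact (one_tmul_eq_zero_iff J (F n) ⟨δ z, hF n z z.2⟩).1 this
  obtain ⟨w, hw, hwz⟩ := hw
  refine ⟨(1 : R ⧸ J) ⊗ₜ[R] (⟨w, hw⟩ : G (i + 1)), ?_⟩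
  change (ModuleCat.of R (R ⧸ J) ◁ (subcomplex δ hδ G hG).d (i + 1) i) _ = _
  rw [subcomplex_d]
  change (1 : R ⧸ J) ⊗ₜ[R] (⟨δ w, hG i w hw⟩ : G i) =
    (1 : R ⧸ J) ⊗ₜ[R] Submodule.inclusion (hFG i) z
  refine (sub_eq_zero.1 ?_).symm
  rw [← TensorProduct.tmul_sub]
  exact (one_tmul_eq_zero_iff J (G i) _).2 hwz

end Homological

/-! ### The resolution of a monomial ideal -/

section Augmentation

open MvPolynomial

variable {σ : Type*} {k : Type*} [CommRing k] (I : Ideal (MvPolynomial σ k))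

lemma boundary_apply_nil_mem {z : ExpChains σ k} (hz : z ∈ monomialChains k (exponents I) 1) :
    boundary _ z [] ∈ I := by
  induction hz using Submodule.span_induction with
  | mem z hz =>
    obtain ⟨a, c, hc, rfl⟩ := hz
    obtain ⟨e, rfl⟩ := List.length_eq_one_iff.1 hc.1
    obtain ⟨he, hea⟩ := hc.2 e (by simp)
    simpa [boundary_single_cons] using monomial_mem_of_mem_exponents he hea 1
  | zero => simp
  | add x y _ _ hx hy => simpa using add_mem hx hy
  | smul r x _ hx => simpa using I.mul_mem_left r hx

/-- The augmentation of the complex of monomial chains of a monomial ideal. -/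
def augmentation : monomialChains k (exponents I) 1 →ₗ[MvPolynomial σ k] I :=
  ((Finsupp.lapply [] ∘ₗ boundary _) ∘ₗ (monomialChains k (exponents I) 1).subtype).codRestrict I
    fun z => boundary_apply_nil_mem I z.2

lemma augmentation_surjective
    (hI : ∀ p ∈ I, ∀ a ∈ p.support, a ∈ exponents I) :
    Function.Surjective (augmentation I) := by
  rintro ⟨p, hp⟩
  -- Each term of `p` is lifted to the vertex given by its own exponent, which is available because
  -- `I` contains the monomials of its elements.
  have hmem : ∑ a ∈ p.support, Finsupp.single [a] (monomial a (p.coeff a)) ∈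
      monomialChains k (exponents I) 1 := by
    refine Submodule.sum_mem _ fun a ha => ?_
    have hc : [a] ∈ boundedLists (exponents I) 1 a := ⟨rfl, by simpa using hI p hp a ha⟩
    exact piece_le_monomialChains (single_mem_piece hc _)
  have hval : boundary (MvPolynomial σ k)
      (∑ a ∈ p.support, Finsupp.single [a] (monomial a (p.coeff a))) [] = p := by
    rw [map_sum, Finsupp.finsetSum_apply]
    refine Eq.trans (Finset.sum_congr rfl fun a _ => ?_) p.as_sum.symm
    rw [boundary_single_cons, boundary_single_nil, map_zero, sub_zero, Finsupp.single_eq_same]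
  exact ⟨⟨_, hmem⟩, Subtype.ext hval⟩

/-- Makes the kernel of the augmentation the kernel of `boundary`, so that `exists_boundary_eq` also
gives exactness at the augmentation. -/
lemma boundary_eq_single_nil {S : Set (σ →₀ ℕ)} {z : ExpChains σ k}
    (hz : z ∈ monomialChains k S 1) : boundary _ z = Finsupp.single [] (boundary _ z []) := by
  induction hz using Submodule.span_induction with
  | mem z hz =>
    obtain ⟨a, c, hc, rfl⟩ := hz
    obtain ⟨e, rfl⟩ := List.length_eq_one_iff.1 hc.1
    simp [boundary_single_cons]
  | zero => simp
  | add x y _ _ hx hy =>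
    rw [map_add, Finsupp.add_apply, Finsupp.single_add, ← hx, ← hy]
  | smul r x _ hx =>
    rw [map_smul, Finsupp.smul_apply, ← Finsupp.smul_single, ← hx]

lemma augmentation_eq_zero_iff (z : monomialChains k (exponents I) 1) :
    augmentation I z = 0 ↔
      ∃ w : monomialChains k (exponents I) 2, boundary _ (w : ExpChains σ k) = z := by
  have : augmentation I z = 0 ↔ boundary _ (z : ExpChains σ k) [] = 0 := Subtype.ext_iff
  rw [this]
  constructor
  · intro h
    obtain ⟨w, hw, hwz⟩ := exists_boundary_eq z.2 (by rw [boundary_eq_single_nil z.2, h]; simp)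
    exact ⟨⟨w, hw⟩, hwz⟩
  · rintro ⟨w, hw⟩
    rw [← hw, boundary_boundary]
    rfl

end Augmentation

/-- An inclusion `I ≤ J` of monomial ideals, `I` proper, is Tor-vanishing if `J` contains all
quotients of a monomial in `I` by a variable dividing it. -/
theorem isTorVanishing_inclusion {k : Type u} [Field k] {m : ℕ}
    {I J : Ideal (MvPolynomial (Fin m) k)} (hIJ : I ≤ J)
    (hI : ∀ p ∈ I, ∀ a ∈ p.support, a ∈ exponents I)
    (hJ : ∀ p ∈ J, ∀ a ∈ p.support, a ∈ exponents J)
    (hdiv : ∀ e ∈ exponents I, ∀ i, e i ≠ 0 → e - Finsupp.single i 1 ∈ exponents J)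
    (hproper : I ≠ ⊤) : IsTorVanishing (Submodule.inclusion hIJ) := by
  have hS : exponents I ⊆ exponents J := fun e he => hIJ he
  have h0 : (0 : Fin m →₀ ℕ) ∉ exponents I := fun h =>
    hproper ((Ideal.eq_top_iff_one I).2 (by simpa [exponents] using h))
  have hfree (S : Set (Fin m →₀ ℕ)) (n : ℕ) :
      Module.Projective (MvPolynomial (Fin m) k) (monomialChains k S (n + 1)) :=
    have := monomialChains_free (k := k) (S := S) (n := n + 1)
    inferInstance
  have := hfree (exponents I)
  have := hfree (exponents J)
  intro i
  -- Homological degree `n` corresponds to lists of length `n + 1`; the empty list serves only as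
  -- the target of the augmentation.
  exact tor_map_eq_zero (boundary _) (F := fun n => monomialChains k (exponents I) (n + 1))
    (G := fun n => monomialChains k (exponents J) (n + 1)) (augmentation I)
    (boundary_boundary _) (fun n z hz => boundary_mem_monomialChains hz)
    (fun n z hz => boundary_mem_monomialChains hz) (gradedMaximalIdeal k m) (augmentation J)
    (augmentation_surjective I hI) (augmentation_surjective J hJ)
    (augmentation_eq_zero_iff I) (augmentation_eq_zero_iff J)
    (fun n z hz hdz => exists_boundary_eq hz hdz) (fun n z hz hdz => exists_boundary_eq hz hdz)
    (fun n => monomialChains_mono hS) (Submodule.inclusion hIJ) (fun z => rfl)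
    (fun z hz => exists_sub_boundary_mem hS hdiv h0 hz (Or.inl rfl))
    (fun n z hz hdz => exists_sub_boundary_mem hS hdiv h0 hz (Or.inr hdz)) i

end SmallType

end

theorem mainTheorem3 {k : Type u} [Field k] {m : ℕ} (I : Ideal (MvPolynomial (Fin m) k))
    (hmon : SmallType.IsMonomialIdeal I) (hproper : I ≠ ⊤) :
    SmallType.IsOfSmallType I := by
  obtain ⟨A, rfl⟩ := hmon
  intro s hs
  obtain ⟨s, rfl⟩ := Nat.exists_eq_add_of_le' hs
  refine SmallType.isTorVanishing_inclusion _
    (fun p hp a ha => SmallType.mem_support_mem_exponents_pow A _ hp ha)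
    (fun p hp a ha => SmallType.mem_support_mem_exponents_pow A _ hp ha)
    (fun e he i hei => SmallType.sub_single_mem_exponents_pow A s he i hei) ?_
  -- Only the smaller ideal `I ^ (s + 1)` must be proper; the larger one is the whole ring when `s =
  -- 0`.
  exact fun h => hproper (top_le_iff.1 (h ▸ Ideal.pow_le_self s.succ_ne_zero))
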